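/- Let $S$ be a (discrete) semigroup with more than one element; it need not have an identity. For $p\in S$ and $X\subseteq S$ put $pS=\{ps: s\in S\}$, $pX=\{px: x\in X\}$, $p^{-1}X=\{y\in S: py\in X\}$. Let $S^*$ be the group of invertible elements of $S$ if $S$ has an identity $1_S$, and $S^*=\emptyset$ otherwise. Let $\mathcal J(S)$ be the smallest family of subsets of $S$ that contains $\emptyset$ and $S$ and is closed under $X\mapsto pX$ and $X\mapsto p^{-1}X$ for all $p\in S$. Assume that $S$ is (left and right) cancellative and right LCM: whenever $pS\cap qS\neq\emptyset$ for $p,q\in S$, there is $r\in(\{p\}\cup pS)\cap(\{q\}\cup qS)$ with $pS\cap qS=rS$. (If $S$ has an identity, this says that $pS\cap qS$ is either empty or a principal right ideal.) If $S^*=\emptyset$, assume also that $aS=bS$ implies $a=b$. Let $C^*(S)$ be the universal unital $C^*$-algebra generated by isometries $(v_p)_{p\in S}$ and projections $(e_X)_{X\in\mathcal J(S)}$ subject to $v_pv_q=v_{pq}$, $v_pe_Xv_p^*=e_{pX}$, $e_\emptyset=0$, $e_S=1$ and $e_Xe_Y=e_{X\cap Y}$, and let $\mathcal D=C^*(\{e_X: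 X\in\mathcal J(S)\})\subseteq C^*(S)$. Assume that there is a conditional expectation $\Phi_{\mathcal D}:C^*(S)\to\mathcal D$ that is faithful on positive elements and satisfies $\Phi_{\mathcal D}(v_pv_q^*)=v_pv_p^*$ if $p=q$ and $\Phi_{\mathcal D}(v_pv_q^*)=0$ if $p\ne q$, where $p,q$ range over $S$ if $S$ has an identity, and over $S\cup\{1\}$ with $v_1=1$ if it has none. Assume moreover: (D3) if $s\in S$ and $F\subseteq S$ is finite with $sS\cap\big(S\setminus\bigcup_{q\in F}qS\big)\ne\emptyset$, then there is $s'\in sS$ with $s'S\cap qS=\emptyset$ for all $q\in F$; and that one of the following holds: 1. $|S^*|\le 1$; 2. $|S^*|>1$ and (D2): for all $s_0\in S$, $s_1\in s_0S$ and finite $F\subseteq S$ with $s_1S\cap\big(S\setminus\bigcup_{q\in F}qS\big)\ne\emptyset$, and for every $x\in S^*\setminus\{1_S\}$, there is $s_2\in s_1S$ with $s_2S\cap\big(S\setminus\bigcup_{q\in F}qS\big)\ne\emptyset$ and $s_0^{-1}s_2S\cap x s_0^{-1}s_2S=\emptyset$; 3. $|S^*|>1$, (D1): for all $x\in S^*$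 and $X\in\mathcal J(S)$, $xX\cap X\neq\emptyset$ implies $xX=X$; and the action of $S^*$ on $\mathcal J(S)$ by left multiplication is strongly effective: for all $x\in S^*\setminus\{1_S\}$ and $p\in S$ there is $q\in pS$ with $xqS\ne qS$. Then $C^*(S)$ is purely infinite and simple: it is nonzero, its only closed two-sided ideals are $0$ and $C^*(S)$, and each of its nonzero hereditary $C^*$-subalgebras contains an infinite projection. -/

import Mathlib

open scoped ENNReal

universe u

noncomputable section

namespace SemigroupCStar

/-! ### Semigroups: ideals, units, right LCM -/

section Semigroups

variable {S : Type u} [Semigroup S]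

/-- The set `pX = {px | x ∈ X}`. -/
def leftMul (p : S) (X : Set S) : Set S := (fun x => p * x) '' X

/-- The set `p⁻¹X = {y | py ∈ X}`. -/
def leftDiv (p : S) (X : Set S) : Set S := (fun y => p * y) ⁻¹' X

/-- The principal right ideal `pS = {ps | s ∈ S}` (it need not contain `p`). -/
def principal (p : S) : Set S := leftMul p Set.univ

/-- The right ideal `⟨p⟩ = {p} ∪ pS` generated by `p`. -/
def generated (p : S) : Set S := insert p (principal p)

/-- `e` is a (two-sided) identity element of `S`. -/
def IsIdentity (e : S) : Prop := ∀ s : S, e * s = s ∧ s * e = s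

variable (S) in
/-- `S*`: the set of invertible elements of `S`; it is empty if `S` has no identity. -/
def unitSet : Set S := {x | ∃ e : S, IsIdentity e ∧ ∃ y : S, x * y = e ∧ y * x = e}

variable (S) in
/-- `S* ∖ {1}`. -/
def nontrivialUnits : Set S := {x | x ∈ unitSet S ∧ ¬ IsIdentity x}

variable (S) in
/-- Right LCM semigroups: left cancellative, and any `p`, `q` with a right common multiple have a
right least common multiple `r`: a common multiple in the sense that `r ∈ ⟨p⟩ ∩ ⟨q⟩`, with
`pS ∩ qS = rS`. If `S` has an identity, then `⟨p⟩ = pS` and `rS = pS ∩ qS` already forces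
`r ∈ pS ∩ qS`, so that this says that `pS ∩ qS` is empty or a principal right ideal. -/
def IsRightLCM : Prop :=
  (∀ p q r : S, p * q = p * r → q = r) ∧
  ∀ p q : S, (principal p ∩ principal q).Nonempty →
    ∃ r : S, r ∈ generated p ∩ generated q ∧ principal p ∩ principal q = principal r

/-- The constructible right ideals: the smallest family of subsets of `S` that contains `∅` and `S`
and is closed under `X ↦ pX` and `X ↦ p⁻¹X`. -/
inductive Constructible : Set S → Prop
  | empty : Constructible ∅
  | univ : Constructible Set.univ
  | leftMul (p : S) {X : Set S} : Constructible X → Constructible (leftMul p X)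
  | leftDiv (p : S) {X : Set S} : Constructible X → Constructible (leftDiv p X)

variable (S) in
/-- The family `J(S)` of constructible right ideals. -/
def J : Type u := {X : Set S // Constructible X}

theorem Constructible.inter [IsLeftCancelMul S] {X Y : Set S} (hX : Constructible X)
    (hY : Constructible Y) : Constructible (X ∩ Y) := by
  induction hX generalizing Y with
  | empty => simpa using Constructible.empty
  | univ => simpa using hY
  | @leftMul p X _ ih =>
    have h : SemigroupCStar.leftMul p X ∩ Y =
        SemigroupCStar.leftMul p (X ∩ SemigroupCStar.leftDiv p Y) :=
      (Set.image_inter_preimage _ _ _).symm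
    rw [h]
    exact (ih (hY.leftDiv p)).leftMul p
  | @leftDiv p X _ ih =>
    have h : SemigroupCStar.leftDiv p X ∩ Y =
        SemigroupCStar.leftDiv p (X ∩ SemigroupCStar.leftMul p Y) := by
      ext y
      simp [SemigroupCStar.leftDiv, SemigroupCStar.leftMul]
    rw [h]
    exact (ih (hY.leftMul p)).leftDiv p

variable (S) in
/-- The action of `S*` on `J(S)` by left multiplication is strongly effective. -/
def StronglyEffective : Prop :=
  ∀ x ∈ nontrivialUnits S, ∀ p : S, ∃ q ∈ principal p, leftMul x (principal q) ≠ principal q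

variable (S) in
/-- Condition (D1). -/
def CondD1 : Prop :=
  ∀ x ∈ unitSet S, ∀ X : Set S, Constructible X → (leftMul x X ∩ X).Nonempty → leftMul x X = X

variable (S) in
/-- Condition (D2). -/
def CondD2 : Prop :=
  ∀ s₀ : S, ∀ s₁ ∈ principal s₀, ∀ F : Finset S,
    (principal s₁ ∩ (⋃ q ∈ F, principal q)ᶜ).Nonempty →
    ∀ x ∈ nontrivialUnits S, ∃ s₂ ∈ principal s₁,
      (principal s₂ ∩ (⋃ q ∈ F, principal q)ᶜ).Nonempty ∧
      leftDiv s₀ (principal s₂) ∩ leftMul x (leftDiv s₀ (principal s₂)) = ∅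

variable (S) in
/-- Condition (D3). -/
def CondD3 : Prop :=
  ∀ s : S, ∀ F : Finset S, (principal s ∩ (⋃ q ∈ F, principal q)ᶜ).Nonempty →
    ∃ s' ∈ principal s, ∀ q ∈ F, principal s' ∩ principal q = ∅

end Semigroups

/-! ### The full semigroup C*-algebra -/

/-- A family of isometries `(v_p)` and projections `(e_X)` in the unital C*-algebra `B` satisfying
the relations (L1)-(L4) of the left cancellative semigroup `S`. -/
structure LiFamily (S : Type u) [Semigroup S] [IsLeftCancelMul S]
    (B : Type*) [CStarAlgebra B] where
  v : S → B
  e : J S → B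
  isometry : ∀ p, star (v p) * v p = 1
  projection : ∀ X, IsStarProjection (e X)
  L1 : ∀ p q, v p * v q = v (p * q)
  L2 : ∀ (p : S) (X : J S), v p * e X * star (v p) = e ⟨leftMul p X.1, X.2.leftMul p⟩
  L3_empty : e ⟨∅, .empty⟩ = 0
  L3_univ : e ⟨Set.univ, .univ⟩ = 1
  L4 : ∀ X Y : J S, e X * e Y = e ⟨X.1 ∩ Y.1, X.2.inter Y.2⟩

/-- A nonzero unital C*-algebra together with a family satisfying the relations. -/
structure LiRep (S : Type u) [Semigroup S] [IsLeftCancelMul S] where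
  B : Type u
  [cstar : CStarAlgebra B]
  [nontrivial : Nontrivial B]
  family : LiFamily S B

attribute [instance] LiRep.cstar LiRep.nontrivial

section FullAlgebra

variable (S : Type u) [Semigroup S] [IsLeftCancelMul S]

/-- The C*-algebra of bounded families in the product of all `B`, over all `LiRep`s. -/
abbrev BigProduct : Type (u + 1) := lp (fun i : LiRep S => i.B) ∞

instance : CStarAlgebra (BigProduct S) where

variable {S}

/-- The element of the product whose coordinates are the `v_p` of all families. -/
def vBig (p : S) : BigProduct S :=
  ⟨fun i => i.family.v p, memℓp_infty ⟨1, by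
    rintro _ ⟨i, rfl⟩
    have h : ‖i.family.v p‖ * ‖i.family.v p‖ = 1 := by
      rw [← CStarRing.norm_star_mul_self, i.family.isometry, norm_one]
    nlinarith [norm_nonneg (i.family.v p)]⟩⟩

/-- The element of the product whose coordinates are the `e_X` of all families. -/
def eBig (X : J S) : BigProduct S :=
  ⟨fun i => i.family.e X, memℓp_infty ⟨1, by
    rintro _ ⟨i, rfl⟩
    exact (i.family.projection X).norm_le⟩⟩

variable (S)

/-- The closed unital *-subalgebra generated by all `v_p` and `e_X`. -/
def fullSubalgebra : StarSubalgebra ℂ (BigProduct S) :=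
  (StarAlgebra.adjoin ℂ (Set.range (vBig (S := S)) ∪ Set.range eBig)).topologicalClosure

/-- The full semigroup C*-algebra `C*(S)`: the universal unital C*-algebra generated by isometries
`v_p` (`p ∈ S`) and projections `e_X` (`X ∈ J(S)`) subject to (L1)-(L4), that is, the completion of
the free unital *-algebra on these symbols in the largest C*-seminorm that is compatible with the
relations. The families in C*-algebras `B : Type u` suffice for this supremum, since a C*-algebra
that is generated by a family indexed by `S` and `J(S)` has a copy in `Type u`. -/
abbrev FullAlgebra : Type (u + 1) := fullSubalgebra S

instance : CStarAlgebra (FullAlgebra S) :=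
  StarSubalgebra.cstarAlgebra (fullSubalgebra S)
    (h_closed := StarSubalgebra.isClosed_topologicalClosure _)

variable {S}

/-- The canonical isometry `v_p` in `C*(S)`. -/
def v (p : S) : FullAlgebra S :=
  ⟨vBig p, StarSubalgebra.le_topologicalClosure _
    (StarAlgebra.subset_adjoin ℂ _ (Or.inl ⟨p, rfl⟩))⟩

/-- The canonical projection `e_X` in `C*(S)`. -/
def e (X : J S) : FullAlgebra S :=
  ⟨eBig X, StarSubalgebra.le_topologicalClosure _
    (StarAlgebra.subset_adjoin ℂ _ (Or.inr ⟨X, rfl⟩))⟩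

variable (S)

/-- The diagonal `D = C*({e_X | X ∈ J(S)})` of `C*(S)`. -/
def diagonal : StarSubalgebra ℂ (FullAlgebra S) :=
  (StarAlgebra.adjoin ℂ (Set.range (e (S := S)))).topologicalClosure

end FullAlgebra

/-! ### C*-algebraic notions -/

section CStar

variable {A : Type*} [CStarAlgebra A]

/-- `a` is a positive element of `A`. -/
def IsPos (a : A) : Prop := ∃ b : A, a = star b * b

/-- `Φ` is a conditional expectation of `A` onto the C*-subalgebra `D`: a positive contractive
`D`-bimodule map that restricts to the identity of `D`. -/
structure IsConditionalExpectation (D : StarSubalgebra ℂ A) (Φ : A →ₗ[ℂ] A) : Prop where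
  mem : ∀ a, Φ a ∈ D
  id_on : ∀ d ∈ D, Φ d = d
  bimodule : ∀ d ∈ D, ∀ d' ∈ D, ∀ a, Φ (d * a * d') = d * Φ a * d'
  positive : ∀ a, IsPos a → IsPos (Φ a)
  contractive : ∀ a, ‖Φ a‖ ≤ ‖a‖

/-- `Φ` is faithful (on positive elements). -/
def IsFaithful (Φ : A →ₗ[ℂ] A) : Prop := ∀ a, IsPos a → Φ a = 0 → a = 0

variable (A) in
/-- Simplicity: `A` is nonzero and has no closed two-sided ideals other than `0` and `A`. -/
def IsSimple : Prop :=
  Nontrivial A ∧ ∀ I : TwoSidedIdeal A, IsClosed (I : Set A) → I = ⊥ ∨ I = ⊤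

/-- `p` is an infinite projection: it is Murray-von Neumann equivalent to a proper subprojection
of itself. -/
def IsInfiniteProjection (p : A) : Prop :=
  IsStarProjection p ∧
    ∃ w : A, star w * w = p ∧ p * (w * star w) = w * star w ∧ w * star w ≠ p

/-- `B` is a hereditary C*-subalgebra of `A`: closed, and `0 ≤ a ≤ b` with `b ∈ B` implies
`a ∈ B`. -/
def IsHereditary (B : NonUnitalStarSubalgebra ℂ A) : Prop :=
  IsClosed (B : Set A) ∧ ∀ a b : A, IsPos a → IsPos (b - a) → b ∈ B → a ∈ B

variable (A) in
/-- `A` is purely infinite (Cuntz's definition for simple C*-algebras): every nonzero hereditary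
C*-subalgebra contains an infinite projection. -/
def IsPurelyInfinite : Prop :=
  ∀ B : NonUnitalStarSubalgebra ℂ A, IsHereditary B → B ≠ ⊥ →
    ∃ p ∈ B, IsInfiniteProjection p

end CStar

/-! ### The expectation onto the diagonal -/

/-- `Φ` is given on the spanning elements of `C*(S)` by `Φ (v_p v_q*) = v_p v_p*` if `p = q` and `0`
if `p ≠ q`, where `p`, `q` range over `S` if `S` has an identity, and over `S ∪ {1}` with `v_1 = 1`
if not (the last clause). -/
structure IsDiagonalMap {S : Type u} [Semigroup S] [IsLeftCancelMul S]
    (Φ : FullAlgebra S →ₗ[ℂ] FullAlgebra S) : Prop where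
  diag : ∀ p : S, Φ (v p * star (v p)) = v p * star (v p)
  off_diag : ∀ p q : S, p ≠ q → Φ (v p * star (v q)) = 0
  no_identity : (¬ ∃ i : S, IsIdentity i) →
    Φ 1 = 1 ∧ ∀ p : S, Φ (v p) = 0 ∧ Φ (star (v p)) = 0

end SemigroupCStar

end

open SemigroupCStar

/-!
Call `v_p v_q*` a monomial. The proof shows that every `c ≠ 0` in `C*(S)` admits an `x` with
`x c* c x* = 1` (`LiFamily.exists_mul_star_mul_self_mul_star_eq_one`). This gives simplicity
(`isSimple_of_forall_exists`), and, as some `v_s` is not unitary, pure infiniteness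
(`isPurelyInfinite_of_forall_exists`). `C*(S)` is nonzero because of the left regular representation
(`regularRep`).

Conjugation by one `v_s` moves `c* c` into the closed span of the monomials with `p, q ∈ S`
(`LiFamily.v_mul_mul_star_v_mem_closure`), whether or not `S` has an identity. Approximate the
result by a finite combination `b` of monomials. Since the expectation `Φ` is faithful and
contractive, `Φ b` is not small. It is a combination of the commuting projections `v_p v_p*`, and
its norm is attained on an atom `f` of the Boolean algebra that they generate
(`exists_atom_norm_le`). The constructible right ideals are `∅`, `S` and the `pS`, and they are
independent (`subset_principal_of_cover`), so that `f ≠ 0` describes a nonempty subset of `S`; by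
(D3) there is `s` whose ideal `sS` lies in or is disjoint from each `pS` as `f` prescribes
(`LiFamily.exists_witness_of_atom`).

It remains to remove the monomials with `p ≠ q`. If `t = p a = q b`, then `v_t* v_p v_q* v_t` equals
`v_a* v_b`, where `a ≠ b` by right cancellation, and it vanishes after replacing `t` by some `ty`
with `ayS ∩ byS = ∅` (`exists_disjoint_mul_right`). If `aS ≠ bS`, then (D3) yields `y`; if `aS = bS`,
then `a` and `b` differ by a nontrivial unit, and each of the three alternatives on `S*` yields `y`
(`exists_disjoint_unit_mul`). The compression of `b` by `v_t` is then a scalar of modulus at least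
`‖Φ b‖` (`LiFamily.exists_compression_eq_smul_one`), and therefore the same compression of the
conjugate of `c* c` is invertible.
-/

namespace SemigroupCStar

/-! ### Right ideals of right LCM semigroups -/

section Semigroup

variable {S : Type u} [Semigroup S]

theorem mem_principal {p s : S} : s ∈ principal p ↔ ∃ y, p * y = s := by
  simp [principal, leftMul]

theorem mul_mem_principal (p y : S) : p * y ∈ principal p := mem_principal.2 ⟨y, rfl⟩

theorem mul_mem_principal_of_mem {p s : S} (h : s ∈ principal p) (y : S) :
    s * y ∈ principal p := by
  obtain ⟨z, rfl⟩ := mem_principal.1 h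
  rw [mul_assoc]
  exact mul_mem_principal _ _

theorem principal_subset_of_mem {p s : S} (h : s ∈ principal p) :
    principal s ⊆ principal p := by
  rintro _ ⟨y, -, rfl⟩
  exact mul_mem_principal_of_mem h y

theorem leftMul_principal (p q : S) : leftMul p (principal q) = principal (p * q) := by
  ext z
  simp [principal, leftMul, mul_assoc]

theorem isIdentity_of_mul_eq_self [IsCancelMul S] {q s : S} (h : q * s = q) :
    IsIdentity s := by
  have hl : ∀ y, s * y = y := fun y => mul_left_cancel (a := q) (by rw [← mul_assoc, h])
  exact fun y => ⟨hl y, mul_right_cancel (b := s) (by rw [mul_assoc, hl])⟩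

theorem IsIdentity.mem_unitSet {i : S} (hi : IsIdentity i) : i ∈ unitSet S :=
  ⟨i, hi, i, (hi i).1, (hi i).1⟩

theorem IsIdentity.eq {i j : S} (hi : IsIdentity i) (hj : IsIdentity j) : i = j := by
  rw [← (hj i).2, (hi j).1]

/-- An element that generates all of `S` as a right ideal is invertible. -/
theorem mem_unitSet_of_principal_eq_univ [IsCancelMul S] {p : S}
    (h : principal p = Set.univ) : p ∈ unitSet S := by
  obtain ⟨i, hi⟩ := mem_principal.1 (h ▸ Set.mem_univ p)
  have hid := isIdentity_of_mul_eq_self hi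
  obtain ⟨q, hq⟩ := mem_principal.1 (h ▸ Set.mem_univ i)
  exact ⟨i, hid, q, hq, mul_left_cancel (a := p) (by rw [← mul_assoc, hq, (hid p).1, (hid p).2])⟩

theorem Constructible.mul_mem {X : Set S} (hX : Constructible X) {x : S} (hx : x ∈ X) (y : S) :
    x * y ∈ X := by
  induction hX generalizing x with
  | empty => exact hx.elim
  | univ => trivial
  | leftMul p _ ih =>
    obtain ⟨z, hz, rfl⟩ := hx
    exact ⟨z * y, ih hz, (mul_assoc _ _ _).symm⟩
  | leftDiv p _ ih =>
    have h := ih (x := p * x) hx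
    rwa [mul_assoc] at h

/-- The principal right ideal `pS` as a constructible right ideal. -/
def principalJ (p : S) : J S := ⟨principal p, Constructible.univ.leftMul p⟩

theorem leftDiv_principal_eq (hLCM : IsRightLCM S) (p q : S) :
    leftDiv p (principal q) = ∅ ∨ leftDiv p (principal q) = Set.univ ∨
      ∃ r, leftDiv p (principal q) = principal r := by
  have hdiv : leftDiv p (principal q) = leftDiv p (principal p ∩ principal q) := by
    ext y
    exact ⟨fun h => ⟨mul_mem_principal p y, h⟩, fun h => h.2⟩
  rcases (principal p ∩ principal q).eq_empty_or_nonempty with h | h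
  · exact .inl (by rw [hdiv, h]; rfl)
  obtain ⟨r, ⟨hrp, -⟩, hr⟩ := hLCM.2 p q h
  rw [hdiv, hr]
  rcases hrp with rfl | hrp
  · exact .inr (.inl (Set.eq_univ_of_forall fun y => mul_mem_principal r y))
  · obtain ⟨t, rfl⟩ := mem_principal.1 hrp
    refine .inr (.inr ⟨t, ?_⟩)
    ext y
    simp only [leftDiv, Set.mem_preimage, mem_principal, mul_assoc]
    exact ⟨fun ⟨z, hz⟩ => ⟨z, hLCM.1 p _ _ hz⟩, fun ⟨z, hz⟩ => ⟨z, by rw [hz]⟩⟩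

/-- In a right LCM semigroup every constructible right ideal is trivial or principal. -/
theorem Constructible.eq_principal (hLCM : IsRightLCM S) {X : Set S} (hX : Constructible X) :
    X = ∅ ∨ X = Set.univ ∨ ∃ p, X = principal p := by
  induction hX with
  | empty => exact .inl rfl
  | univ => exact .inr (.inl rfl)
  | leftMul p _ ih =>
    rcases ih with rfl | rfl | ⟨q, rfl⟩
    · exact .inl (Set.image_empty _)
    · exact .inr (.inr ⟨p, rfl⟩)
    · exact .inr (.inr ⟨_, leftMul_principal p q⟩)
  | leftDiv p _ ih =>
    rcases ih with rfl | rfl | ⟨q, rfl⟩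
    · exact .inl rfl
    · exact .inr (.inl rfl)
    · exact leftDiv_principal_eq hLCM p q

/-- If finitely many principal right ideals cover `S`, then one of them is `S`. Without an
identity no such cover exists: `q ∈ rS` is then a strict order, and a minimal generator
lies in none of the ideals. -/
theorem exists_principal_eq_univ_of_cover [IsCancelMul S] [Nonempty S] (Q : Set S)
    (hQ : Q.Finite) (h : ∀ y, ∃ q ∈ Q, y ∈ principal q) :
    ∃ q ∈ Q, principal q = Set.univ := by
  by_cases hid : ∃ i : S, IsIdentity i
  · obtain ⟨i, hi⟩ := hid
    obtain ⟨q, hq, hiq⟩ := h i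
    refine ⟨q, hq, Set.eq_univ_of_forall fun y => ?_⟩
    rw [← (hi y).1]
    exact mul_mem_principal_of_mem hiq y
  · exfalso
    have : Finite Q := hQ
    let r : Q → Q → Prop := fun a b => (b : S) ∈ principal (a : S)
    have : IsTrans Q r := ⟨fun a b c hab hbc => principal_subset_of_mem hab hbc⟩
    have : Std.Irrefl r := ⟨fun a ha => by
      obtain ⟨s, hs⟩ := mem_principal.1 ha
      exact hid ⟨s, isIdentity_of_mul_eq_self hs⟩⟩
    have hwf : WellFounded r := Finite.wellFounded_of_trans_of_irrefl r
    obtain ⟨q₀, hq₀, -⟩ := h (Classical.arbitrary S)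
    obtain ⟨m, -, hm⟩ := hwf.has_min Set.univ ⟨⟨q₀, hq₀⟩, trivial⟩
    obtain ⟨q, hq, hmq⟩ := h m
    exact hm ⟨q, hq⟩ trivial hmq

/-- Independence of the constructible right ideals: one that is covered by finitely many principal
right ideals lies in one of them. -/
theorem subset_principal_of_cover [IsCancelMul S] [Nonempty S]
    (hLCM : IsRightLCM S) {X : Set S} (hX : Constructible X) (hne : X.Nonempty) (Q : Finset S)
    (h : ∀ y ∈ X, ∃ q ∈ Q, y ∈ principal q) : ∃ q ∈ Q, X ⊆ principal q := by
  rcases hX.eq_principal hLCM with rfl | rfl | ⟨t, rfl⟩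
  · exact absurd hne Set.not_nonempty_empty
  · obtain ⟨q, hq, hqu⟩ := exists_principal_eq_univ_of_cover (Q : Set S) Q.finite_toSet
      (fun y => h y trivial)
    exact ⟨q, hq, hqu.ge⟩
  · by_contra! hcon
    -- The ideals `t⁻¹(qS)` cover `S`, and none of them is `S`.
    have hdiv : ∀ q ∈ Q, leftDiv t (principal q) ≠ Set.univ := fun q hq hu => by
      refine hcon q hq ?_
      rintro _ ⟨y, -, rfl⟩
      exact hu.ge (Set.mem_univ y)
    let gen : S → S := fun q => Classical.epsilon fun r => leftDiv t (principal q) = principal r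
    have hgen : ∀ q ∈ Q, ∀ y ∈ leftDiv t (principal q),
        leftDiv t (principal q) = principal (gen q) := by
      intro q hq y hy
      rcases leftDiv_principal_eq hLCM t q with h0 | h1 | h2
      · exact absurd (h0 ▸ hy) (Set.notMem_empty y)
      · exact absurd h1 (hdiv q hq)
      · exact Classical.epsilon_spec h2
    let Q' : Set S := {r | ∃ q ∈ Q, leftDiv t (principal q) = principal r ∧ gen q = r}
    have hfin : Q'.Finite := (Q.finite_toSet.image gen).subset fun r ⟨q, hq, _, hr⟩ => ⟨q, hq, hr⟩
    obtain ⟨r, ⟨q, hq, hqr, -⟩, hr⟩ := exists_principal_eq_univ_of_cover Q' hfin fun y => by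
      obtain ⟨q, hq, hy⟩ := h (t * y) (mul_mem_principal t y)
      have hg := hgen q hq y hy
      exact ⟨gen q, ⟨q, hq, hg, rfl⟩, hg ▸ hy⟩
    exact hdiv q hq (hqr.trans hr)

theorem disjoint_principal_mul_left [IsCancelMul S] {p s q : S} :
    principal (p * s) ∩ principal (p * q) = ∅ ↔ principal s ∩ principal q = ∅ := by
  rw [← leftMul_principal, ← leftMul_principal, leftMul, leftMul,
    ← Set.image_inter (mul_right_injective p), Set.image_eq_empty]

theorem disjoint_principal_of_mem {s t q : S} (h : principal s ∩ principal q = ∅)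
    (ht : t ∈ principal s) : principal t ∩ principal q = ∅ :=
  Set.eq_empty_of_subset_empty
    ((Set.inter_subset_inter_left _ (principal_subset_of_mem ht)).trans h.le)

/-- Condition (D3) for an arbitrary constructible right ideal. The ideal `S`, which is not
principal if `S` has no identity, is reduced to `pS` by translation. -/
theorem CondD3.exists_mem [IsCancelMul S] [Nonempty S] (hLCM : IsRightLCM S) (hD3 : CondD3 S)
    {X : Set S} (hX : Constructible X) (Q : Finset S) {z : S} (hz : z ∈ X)
    (hzQ : ∀ q ∈ Q, z ∉ principal q) :
    ∃ s ∈ X, ∀ q ∈ Q, principal s ∩ principal q = ∅ := by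
  classical
  rcases hX.eq_principal hLCM with rfl | rfl | ⟨t, rfl⟩
  · exact hz.elim
  · let p : S := Classical.arbitrary S
    obtain ⟨s, hs, hsQ⟩ := hD3 p (Q.image (p * ·)) ⟨p * z, mul_mem_principal p z, by
      simp only [Set.mem_compl_iff, Set.mem_iUnion, not_exists, Finset.mem_image]
      rintro _ ⟨q, hq, rfl⟩ hpz
      rw [← leftMul_principal] at hpz
      obtain ⟨y, hy, hyz⟩ := hpz
      exact hzQ q hq (mul_left_cancel hyz ▸ hy)⟩
    obtain ⟨y, rfl⟩ := mem_principal.1 hs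
    exact ⟨y, trivial, fun q hq =>
      disjoint_principal_mul_left.1 (hsQ _ (Finset.mem_image_of_mem _ hq))⟩
  · exact hD3 t Q ⟨z, hz, by simpa using hzQ⟩

/-- Each of the alternatives on `S*` separates the nontrivial units from the identity: for
`x ≠ 1` invertible there is `y` with `yS ∩ xyS = ∅`. -/
theorem exists_disjoint_unit_mul
    (hcases : (unitSet S).encard ≤ 1 ∨ (1 < (unitSet S).encard ∧ CondD2 S) ∨
      (1 < (unitSet S).encard ∧ CondD1 S ∧ StronglyEffective S))
    {x : S} (hx : x ∈ nontrivialUnits S) :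
    ∃ y, principal y ∩ principal (x * y) = ∅ := by
  obtain ⟨i, hi, -⟩ := hx.1
  rcases hcases with h | ⟨-, h⟩ | ⟨-, h1, h2⟩
  · have := Set.encard_le_one_iff.1 h x i hx.1 hi.mem_unitSet
    exact absurd (this ▸ hi) hx.2
  · have hii : i ∈ principal i := mem_principal.2 ⟨i, (hi i).1⟩
    obtain ⟨s, -, -, hs⟩ := h i i hii ∅ ⟨i, hii, by simp⟩ x hx
    have hdiv : leftDiv i (principal s) = principal s := by
      ext y
      simp [leftDiv, (hi y).1]
    exact ⟨s, by rwa [hdiv, leftMul_principal] at hs⟩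
  · obtain ⟨q, -, hq⟩ := h2 x hx i
    refine ⟨q, ?_⟩
    by_contra hne
    refine hq (h1 x hx.1 _ (Constructible.univ.leftMul q) ?_)
    rw [Set.inter_comm]
    rw [leftMul_principal]
    exact Set.nonempty_iff_ne_empty.2 hne

/-- Distinct elements have translates that generate disjoint right ideals. If the ideals `sS` and
`tS` differ, this is (D3); if they agree, then `s` and `t` differ by a nontrivial unit. -/
theorem exists_disjoint_mul_right [IsCancelMul S] [Nonempty S]
    (hNoUnits : unitSet S = ∅ → ∀ a b : S, principal a = principal b → a = b)
    (hD3 : CondD3 S)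
    (hunit : ∀ x ∈ nontrivialUnits S, ∃ y, principal y ∩ principal (x * y) = ∅)
    {s t : S} (hst : s ≠ t) : ∃ y, principal (s * y) ∩ principal (t * y) = ∅ := by
  have key : ∀ {s t : S}, ¬ principal s ⊆ principal t →
      ∃ y, principal (s * y) ∩ principal (t * y) = ∅ := by
    intro s t h
    obtain ⟨z, hzs, hzt⟩ := Set.not_subset.1 h
    obtain ⟨s', hs', hd⟩ := hD3 s {t} ⟨z, hzs, by simpa using hzt⟩
    obtain ⟨y, rfl⟩ := mem_principal.1 hs'
    have h1 := hd t (Finset.mem_singleton_self t)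
    rw [Set.inter_comm] at h1
    exact ⟨y, by rw [Set.inter_comm]; exact disjoint_principal_of_mem h1 (mul_mem_principal t y)⟩
  by_cases h₁ : principal s ⊆ principal t
  · by_cases h₂ : principal t ⊆ principal s
    · have heq := h₁.antisymm h₂
      have hne : unitSet S ≠ ∅ := fun h0 => hst (hNoUnits h0 s t heq)
      obtain ⟨-, i, hi, -⟩ := Set.nonempty_iff_ne_empty.2 hne
      obtain ⟨x, hx⟩ := mem_principal.1 (h₂ (mem_principal.2 ⟨i, (hi t).2⟩))
      obtain ⟨x', hx'⟩ := mem_principal.1 (h₁ (mem_principal.2 ⟨i, (hi s).2⟩))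
      have h1 : x * x' = i :=
        mul_left_cancel (a := s) (by rw [← mul_assoc, hx, hx', (hi s).2])
      have h2 : x' * x = i :=
        mul_left_cancel (a := t) (by rw [← mul_assoc, hx', hx, (hi t).2])
      have hxi : ¬ IsIdentity x := fun h => hst (by rw [← hx, (h s).2])
      obtain ⟨y, hy⟩ := hunit x ⟨⟨i, hi, x', h1, h2⟩, hxi⟩
      refine ⟨y, ?_⟩
      rw [← hx, mul_assoc]
      exact disjoint_principal_mul_left.2 hy
    · obtain ⟨y, hy⟩ := key h₂
      exact ⟨y, by rwa [Set.inter_comm]⟩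
  · exact key h₁

/-- Under (D3), some principal right ideal is disjoint from another one. -/
theorem exists_disjoint_principal [IsCancelMul S] [Nontrivial S] (hLCM : IsRightLCM S)
    (hD3 : CondD3 S)
    (hunit : ∀ x ∈ nontrivialUnits S, ∃ y, principal y ∩ principal (x * y) = ∅) :
    ∃ s t : S, principal s ∩ principal t = ∅ := by
  by_cases h : ∃ p : S, principal p ≠ Set.univ
  · obtain ⟨p, hp⟩ := h
    obtain ⟨z, hz⟩ := (Set.ne_univ_iff_exists_notMem _).1 hp
    obtain ⟨s, -, hs⟩ := hD3.exists_mem hLCM Constructible.univ {p} (Set.mem_univ z)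
      (by simpa using hz)
    exact ⟨s, p, hs p (Finset.mem_singleton_self p)⟩
  · -- Here `S` is a group, so that it has nontrivial units.
    push Not at h
    obtain ⟨a, b, hab⟩ := exists_pair_ne S
    have hx : ∃ x : S, ¬ IsIdentity x := by
      by_contra! hall
      exact hab ((hall a).eq (hall b))
    obtain ⟨x, hx⟩ := hx
    obtain ⟨y, hy⟩ := hunit x ⟨mem_unitSet_of_principal_eq_univ (h x), hx⟩
    exact ⟨_, _, hy⟩

end Semigroup

/-! ### Projections and Cuntz's criterion in C*-algebras -/

section CStarAlgebra

variable {A : Type*} [CStarAlgebra A]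

/-- Cutting by a projection `f` and by `1 - f` computes the norm of an element that commutes with
`f`. -/
theorem norm_le_max_of_commute {f y : A} (hf : IsStarProjection f) (hfy : Commute f y) :
    ‖y‖ ≤ max ‖f * y‖ ‖(1 - f) * y‖ := by
  let _ := CStarAlgebra.spectralOrder A
  let _ := CStarAlgebra.spectralOrderedRing A
  set m := max ‖f * y‖ ‖(1 - f) * y‖
  have hm0 : 0 ≤ m := le_max_of_le_left (norm_nonneg _)
  have key : ∀ {g : A}, IsStarProjection g → Commute g y → ‖g * y‖ ≤ m →
      star y * g * y ≤ (m ^ 2) • g := by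
    intro g hg hgy hle
    have hgg : g * g = g := hg.isIdempotentElem
    have hgs : star g = g := hg.isSelfAdjoint
    have hgy' : Commute g (star y) := by
      have := hgy.star_star
      rwa [hgs] at this
    have h1 : star (g * y) * (g * y) = star y * g * y := by
      rw [star_mul, hgs, mul_assoc, ← mul_assoc g g, hgg, mul_assoc]
    have h2 : star g * (star y * g * y) * g = star y * g * y := by
      rw [hgs, mul_assoc, mul_assoc, ← hgy.eq, ← mul_assoc (star y * g) g y,
        mul_assoc (star y) g g, hgg, ← mul_assoc, ← mul_assoc, hgy'.eq, mul_assoc (star y) g g, hgg]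
    have h3 : ‖star y * g * y‖ = ‖g * y‖ * ‖g * y‖ := by
      rw [← h1, CStarRing.norm_star_mul_self]
    have hsa : IsSelfAdjoint (star y * g * y) := by
      rw [← h1]; exact IsSelfAdjoint.star_mul_self _
    calc star y * g * y = star g * (star y * g * y) * g := h2.symm
      _ ≤ ‖star y * g * y‖ • (star g * g) := CStarAlgebra.star_left_conjugate_le_norm_smul
      _ = ‖star y * g * y‖ • g := by rw [hgs, hgg]
      _ ≤ (m ^ 2) • g := by
        refine smul_le_smul_of_nonneg_right ?_ hg.nonneg
        rw [h3, sq]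
        exact mul_self_le_mul_self (norm_nonneg _) hle
  have h1 := key hf hfy (le_max_left _ _)
  have h2 := key hf.one_sub ((Commute.one_left y).sub_left hfy) (le_max_right _ _)
  have h3 : star y * y ≤ (m ^ 2) • (1 : A) := by
    calc star y * y = star y * f * y + star y * (1 - f) * y := by noncomm_ring
      _ ≤ (m ^ 2) • f + (m ^ 2) • (1 - f) := add_le_add h1 h2
      _ = (m ^ 2) • (1 : A) := by rw [← smul_add]; simp
  have h4 : ‖star y * y‖ ≤ m ^ 2 := by
    refine (CStarAlgebra.norm_le_iff_le_algebraMap _ (by positivity) (star_mul_self_nonneg y)).2 ?_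
    rwa [Algebra.algebraMap_eq_smul_one]
  rw [CStarRing.norm_star_mul_self, ← sq] at h4
  exact (pow_le_pow_iff_left₀ (norm_nonneg _) hm0 two_ne_zero).1 h4

/-- Given finitely many commuting projections `e i` and an element `y` that commutes with them,
some atom `f` of the Boolean algebra that the `e i` generate satisfies `‖y‖ ≤ ‖f y‖`. -/
theorem exists_atom_norm_le {ι : Type*} {e : ι → A} (he : ∀ i, IsStarProjection (e i))
    (hcomm : ∀ i j, Commute (e i) (e j)) (P : Finset ι) {y : A}
    (hy : ∀ i, Commute (e i) y) :
    ∃ f : A, ‖f‖ ≤ 1 ∧ (∀ i, Commute (e i) f) ∧ (∀ i ∈ P, f * e i = f ∨ f * e i = 0) ∧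
      ‖y‖ ≤ ‖f * y‖ := by
  classical
  induction P using Finset.induction_on with
  | empty =>
    exact ⟨1, IsStarProjection.norm_le 1 (.one A), fun i => .one_right _, by simp, by simp⟩
  | insert p P _ ih =>
    obtain ⟨f, hf1, hfc, hfP, hfy⟩ := ih
    have hle := norm_le_max_of_commute (he p) ((hfc p).mul_right (hy p))
    have hidem : e p * e p = e p := (he p).isIdempotentElem
    -- The new atom is `g f` for `g = e p` or `g = 1 - e p`, whichever carries the norm.
    have step : ∀ g : A, IsStarProjection g → (∀ i, Commute (e i) g) →
        (g * e p = g ∨ g * e p = 0) → ‖f * y‖ ≤ ‖g * (f * y)‖ →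
        ∃ f : A, ‖f‖ ≤ 1 ∧ (∀ i, Commute (e i) f) ∧
          (∀ i ∈ insert p P, f * e i = f ∨ f * e i = 0) ∧ ‖y‖ ≤ ‖f * y‖ := by
      intro g hg hgc hgp hgy
      refine ⟨g * f, ?_, fun i => (hgc i).mul_right (hfc i), ?_, ?_⟩
      · exact (norm_mul_le _ _).trans (mul_le_one₀ hg.norm_le (norm_nonneg _) hf1)
      · intro i hi
        rcases Finset.mem_insert.1 hi with rfl | hi
        · rw [mul_assoc, ← (hfc i).eq, ← mul_assoc]
          rcases hgp with h | h <;> simp [h]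
        · rcases hfP i hi with h | h <;> simp [mul_assoc, h]
      · rw [mul_assoc]
        exact hfy.trans hgy
    rcases le_max_iff.1 hle with h | h
    · exact step _ (he p) (fun i => hcomm i p) (.inl hidem) h
    · exact step _ (he p).one_sub (fun i => (Commute.one_right _).sub_right (hcomm i p))
        (.inr (by rw [sub_mul, one_mul, hidem, sub_self])) h

/-- If `g = h* h` is invertible, then `x g x* = 1` for `x = g^(-1/2)`. -/
theorem exists_mul_mul_star_eq_one {h : A} (hu : IsUnit (star h * h)) :
    ∃ x : A, x * (star h * h) * star x = 1 := by
  let _ := CStarAlgebra.spectralOrder A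
  let _ := CStarAlgebra.spectralOrderedRing A
  have h0 : 0 ≤ star h * h := star_mul_self_nonneg h
  obtain ⟨r, hr⟩ := (CFC.isUnit_sqrt_iff _ h0).2 hu
  have hs : star (r : A) = r := by
    rw [hr]; exact (CFC.sqrt_nonneg _).isSelfAdjoint
  have hs' : star ((r⁻¹ : Aˣ) : A) = ((r⁻¹ : Aˣ) : A) := by
    rw [← Units.coe_star, star_inv]
    congr 2
    exact Units.ext hs
  refine ⟨((r⁻¹ : Aˣ) : A), ?_⟩
  rw [hs', ← CFC.sqrt_mul_sqrt_self _ h0, ← hr, ← mul_assoc, Units.inv_mul, one_mul, Units.mul_inv]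

/-- Cuntz's criterion for simplicity: `x c* c x* = 1` is solvable for every `c ≠ 0`. -/
theorem isSimple_of_forall_exists [Nontrivial A]
    (h : ∀ c : A, c ≠ 0 → ∃ x : A, x * (star c * c) * star x = 1) : IsSimple A := by
  refine ⟨inferInstance, fun I _ => or_iff_not_imp_left.2 fun hI => ?_⟩
  obtain ⟨c, hcI, hc⟩ : ∃ c ∈ I, c ≠ 0 := by
    by_contra! hcon
    refine hI (le_bot_iff.1 fun c hc => ?_)
    rw [TwoSidedIdeal.mem_bot]
    exact hcon c hc
  obtain ⟨x, hx⟩ := h c hc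
  have h1 : (1 : A) ∈ I :=
    hx ▸ I.mul_mem_right _ _ (I.mul_mem_left _ _ (I.mul_mem_left _ _ hcI))
  refine top_le_iff.1 fun a _ => ?_
  simpa using I.mul_mem_left a 1 h1

/-- If moreover `A` has a nonunitary isometry `v`, then `A` is purely infinite: for `c ≠ 0` in a
hereditary subalgebra `B` and `x c* c x* = 1`, the element `w = c x*` is an isometry with range
projection in `B`, and `w v w*` shows that this projection is infinite. -/
theorem isPurelyInfinite_of_forall_exists
    (h : ∀ c : A, c ≠ 0 → ∃ x : A, x * (star c * c) * star x = 1) {v : A}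
    (hv : star v * v = 1) (hv' : v * star v ≠ 1) : IsPurelyInfinite A := by
  intro B ⟨_, hB⟩ hne
  obtain ⟨c, hcB, hc⟩ : ∃ c ∈ B, c ≠ 0 := by
    by_contra! hcon
    exact hne (le_bot_iff.1 fun c hc => NonUnitalStarAlgebra.mem_bot.2 (hcon c hc))
  obtain ⟨x, hx⟩ := h c hc
  set w := c * star x with hw
  have hww : star w * w = 1 := by
    rw [← hx, hw]; simp [mul_assoc]
  have hp : IsStarProjection (w * star w) :=
    ⟨by rw [IsIdempotentElem, mul_assoc, ← mul_assoc (star w), hww, one_mul],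
      IsSelfAdjoint.mul_star_self w⟩
  refine ⟨w * star w, ?_, hp, w * v * star w, ?_, ?_, ?_⟩
  · -- The range projection of `w` is at most `‖x‖² c c*`, an element of `B`.
    refine hB _ ((‖x‖ ^ 2 : ℂ) • (c * star c)) ⟨star w, by simp⟩ ?_
      (SMulMemClass.smul_mem _ (mul_mem hcB (star_mem hcB)))
    let _ := CStarAlgebra.spectralOrder A
    let _ := CStarAlgebra.spectralOrderedRing A
    have hle : star x * x ≤ algebraMap ℝ A (‖x‖ ^ 2) :=
      CStarAlgebra.star_mul_le_algebraMap_norm_sq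
    obtain ⟨r, hr⟩ := CStarAlgebra.nonneg_iff_eq_star_mul_self.1 (sub_nonneg.2 hle)
    refine ⟨r * star c, ?_⟩
    have h1 : star (r * star c) * (r * star c) = c * (star r * r) * star c := by
      simp [mul_assoc]
    rw [h1, ← hr, hw, mul_sub, sub_mul, Algebra.algebraMap_eq_smul_one]
    simp only [star_mul, star_star, mul_assoc, mul_smul_comm, smul_mul_assoc, mul_one]
    congr 1
    rw [← Complex.ofReal_pow, Complex.coe_smul]
  · calc star (w * v * star w) * (w * v * star w)
        = w * star v * (star w * w) * v * star w := by simp [mul_assoc]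
      _ = w * (star v * v) * star w := by rw [hww]; simp [mul_assoc]
      _ = w * star w := by rw [hv, mul_one]
  · calc w * star w * (w * v * star w * star (w * v * star w))
        = w * (star w * w) * v * star w * star (w * v * star w) := by simp only [mul_assoc]
      _ = w * v * star w * star (w * v * star w) := by rw [hww, mul_one]
  · intro heq
    refine hv' ?_
    calc v * star v = (star w * w) * v * (star w * w) * star v * (star w * w) := by simp [hww]
      _ = star w * (w * v * star w * star (w * v * star w)) * w := by simp [mul_assoc]
      _ = (star w * w) * (star w * w) := by rw [heq]; simp [mul_assoc]
      _ = 1 := by rw [hww, one_mul]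

end CStarAlgebra

/-! ### Compressing combinations of monomials to scalars -/

namespace LiFamily

variable {S : Type u} [Semigroup S] [IsCancelMul S] {A : Type*} [CStarAlgebra A]
  (L : LiFamily S A)

theorem v_mul_star_v (p : S) :
    L.v p * star (L.v p) = L.e (principalJ p) := by
  have h := L.L2 p ⟨Set.univ, .univ⟩
  rw [L.L3_univ, mul_one] at h
  exact h

theorem isStarProjection_range (p : S) : IsStarProjection (L.v p * star (L.v p)) := by
  rw [v_mul_star_v]
  exact L.projection _

theorem e_mul_e_of_subset {X Y : J S} (h : X.1 ⊆ Y.1) : L.e X * L.e Y = L.e X := by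
  rw [L.L4]
  congr 1
  exact Subtype.ext (Set.inter_eq_left.2 h)

theorem e_eq_zero {X : J S} (h : X.1 = ∅) : L.e X = 0 := by
  rw [← L.L3_empty]
  congr 1
  exact Subtype.ext h

theorem e_mul_e_of_disjoint {X Y : J S} (h : X.1 ∩ Y.1 = ∅) : L.e X * L.e Y = 0 :=
  (L.L4 X Y).trans (L.e_eq_zero h)

theorem commute_e (X Y : J S) : Commute (L.e X) (L.e Y) := by
  rw [Commute, SemiconjBy, L.L4, L.L4]
  congr 1
  exact Subtype.ext (Set.inter_comm _ _)

theorem commute_range (p q : S) :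
    Commute (L.v p * star (L.v p)) (L.v q * star (L.v q)) := by
  rw [v_mul_star_v, v_mul_star_v]
  exact L.commute_e _ _

theorem star_v_mul_v_eq (p q : S) : star (L.v p) * L.v q =
    star (L.v p) * (L.v p * star (L.v p) * (L.v q * star (L.v q))) * L.v q := by
  calc star (L.v p) * L.v q
      = (star (L.v p) * L.v p) * star (L.v p) * L.v q * (star (L.v q) * L.v q) := by
        rw [L.isometry, L.isometry, one_mul, mul_one]
    _ = _ := by simp only [mul_assoc]

theorem star_v_mul_v_of_disjoint {p q : S} (h : principal p ∩ principal q = ∅) :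
    star (L.v p) * L.v q = 0 := by
  rw [star_v_mul_v_eq, v_mul_star_v, v_mul_star_v,
    L.e_mul_e_of_disjoint (X := principalJ p) (Y := principalJ q) h, mul_zero, zero_mul]

/-- If `r` is a right LCM of `p` and `q`, then `v_p* v_q` factors through the range of `v_r`. -/
theorem star_v_mul_v_of_eq {p q r : S} (h : principal p ∩ principal q = principal r) :
    star (L.v p) * L.v q = (star (L.v p) * L.v r) * (star (L.v r) * L.v q) := by
  have hr : L.v p * star (L.v p) * (L.v q * star (L.v q)) = L.v r * star (L.v r) := by
    rw [v_mul_star_v, v_mul_star_v, v_mul_star_v, L.L4]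
    congr 1
    exact Subtype.ext h
  rw [star_v_mul_v_eq, hr]
  simp only [mul_assoc]

theorem star_v_mul_v_mul (p y : S) : star (L.v p) * L.v (p * y) = L.v y := by
  rw [← L.L1, ← mul_assoc, L.isometry, one_mul]

theorem star_v_mul_mul_v (p y : S) : star (L.v (p * y)) * L.v p = star (L.v y) := by
  rw [← L.L1, star_mul, mul_assoc, L.isometry, mul_one]

/-- The linear span of the elements `v_p v_q*` with `p, q ∈ S`. -/
noncomputable def monomialSpan : Submodule ℂ A :=
  Submodule.span ℂ (Set.range fun i : S × S => L.v i.1 * star (L.v i.2))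

/-- The linear span of the elements `v_q*` and `v_p v_q*` with `p, q ∈ S`. It is a left ideal of
the *-algebra generated by the family. -/
noncomputable def leftSpan : Submodule ℂ A :=
  Submodule.span ℂ {a | (∃ q, a = star (L.v q)) ∨ ∃ p q, a = L.v p * star (L.v q)}

theorem star_v_mem_leftSpan (q : S) : star (L.v q) ∈ L.leftSpan :=
  Submodule.subset_span (.inl ⟨q, rfl⟩)

theorem monomial_mem_leftSpan (p q : S) : L.v p * star (L.v q) ∈ L.leftSpan :=
  Submodule.subset_span (.inr ⟨p, q, rfl⟩)

theorem mul_mem_leftSpan {a : A} (h₁ : ∀ q, a * star (L.v q) ∈ L.leftSpan)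
    (h₂ : ∀ p q, a * (L.v p * star (L.v q)) ∈ L.leftSpan) {k : A} (hk : k ∈ L.leftSpan) :
    a * k ∈ L.leftSpan := by
  refine Submodule.span_induction (p := fun k _ => a * k ∈ L.leftSpan) ?_ ?_ ?_ ?_ hk
  · rintro _ (⟨q, rfl⟩ | ⟨p, q, rfl⟩)
    · exact h₁ q
    · exact h₂ p q
  · simp
  · intro x y _ _ hx hy
    rw [mul_add]
    exact add_mem hx hy
  · intro c x _ hx
    rw [mul_smul_comm]
    exact Submodule.smul_mem _ c hx

theorem v_mul_mem_leftSpan (p : S) {k : A} (hk : k ∈ L.leftSpan) : L.v p * k ∈ L.leftSpan := by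
  refine L.mul_mem_leftSpan (fun q => L.monomial_mem_leftSpan p q) (fun q r => ?_) hk
  rw [← mul_assoc, L.L1]
  exact L.monomial_mem_leftSpan _ _

theorem star_v_mul_mem_leftSpan (hLCM : IsRightLCM S) (p : S) {k : A} (hk : k ∈ L.leftSpan) :
    star (L.v p) * k ∈ L.leftSpan := by
  have hstar : ∀ q r, star (L.v q) * star (L.v r) = star (L.v (r * q)) := fun q r => by
    rw [← star_mul, L.L1]
  refine L.mul_mem_leftSpan (fun q => ?_) (fun q r => ?_) hk
  · rw [hstar]
    exact L.star_v_mem_leftSpan _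
  rw [← mul_assoc]
  rcases (principal p ∩ principal q).eq_empty_or_nonempty with h | h
  · rw [L.star_v_mul_v_of_disjoint h, zero_mul]
    exact zero_mem _
  obtain ⟨t, ⟨htp, htq⟩, ht⟩ := hLCM.2 p q h
  rw [L.star_v_mul_v_of_eq ht]
  have hright : star (L.v t) * L.v q * star (L.v r) ∈ L.leftSpan := by
    rcases htq with rfl | htq
    · rw [L.isometry, one_mul]
      exact L.star_v_mem_leftSpan r
    · obtain ⟨y, rfl⟩ := mem_principal.1 htq
      rw [star_v_mul_mul_v, hstar]
      exact L.star_v_mem_leftSpan _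
  rw [mul_assoc]
  rcases htp with rfl | htp
  · rwa [L.isometry, one_mul]
  · obtain ⟨y, rfl⟩ := mem_principal.1 htp
    rw [star_v_mul_v_mul]
    exact L.v_mul_mem_leftSpan y hright

theorem e_mul_mem_leftSpan (hLCM : IsRightLCM S) (X : J S) {k : A} (hk : k ∈ L.leftSpan) :
    L.e X * k ∈ L.leftSpan := by
  obtain ⟨X, hX⟩ := X
  rcases hX.eq_principal hLCM with rfl | rfl | ⟨p, rfl⟩
  · rw [L.L3_empty, zero_mul]
    exact zero_mem _
  · rwa [L.L3_univ, one_mul]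
  · have he : L.e ⟨principal p, hX⟩ = L.v p * star (L.v p) := (L.v_mul_star_v p).symm
    rw [he, mul_assoc]
    exact L.v_mul_mem_leftSpan p (L.star_v_mul_mem_leftSpan hLCM p hk)

theorem adjoin_mul_mem_leftSpan (hLCM : IsRightLCM S) {a : A}
    (ha : a ∈ StarAlgebra.adjoin ℂ (Set.range L.v ∪ Set.range L.e)) {k : A}
    (hk : k ∈ L.leftSpan) : a * k ∈ L.leftSpan := by
  suffices h : (∀ k ∈ L.leftSpan, a * k ∈ L.leftSpan) ∧
      ∀ k ∈ L.leftSpan, star a * k ∈ L.leftSpan from h.1 k hk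
  have hscal : ∀ (r : ℂ), ∀ k ∈ L.leftSpan, algebraMap ℂ A r * k ∈ L.leftSpan := fun r k hk => by
    rw [← Algebra.smul_def]
    exact Submodule.smul_mem _ r hk
  refine StarAlgebra.adjoin_induction (p := fun a _ => (∀ k ∈ L.leftSpan, a * k ∈ L.leftSpan) ∧
    ∀ k ∈ L.leftSpan, star a * k ∈ L.leftSpan) ?_ ?_ ?_ ?_ ?_ ha
  · rintro _ (⟨p, rfl⟩ | ⟨X, rfl⟩)
    · exact ⟨fun k hk => L.v_mul_mem_leftSpan p hk, fun k hk => L.star_v_mul_mem_leftSpan hLCM p hk⟩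
    · refine ⟨fun k hk => L.e_mul_mem_leftSpan hLCM X hk, fun k hk => ?_⟩
      rw [(L.projection X).isSelfAdjoint.star_eq]
      exact L.e_mul_mem_leftSpan hLCM X hk
  · intro r
    refine ⟨hscal r, fun k hk => ?_⟩
    rw [← algebraMap_star_comm]
    exact hscal _ k hk
  · intro x y _ _ hx hy
    refine ⟨fun k hk => ?_, fun k hk => ?_⟩
    · rw [add_mul]
      exact add_mem (hx.1 k hk) (hy.1 k hk)
    · rw [star_add, add_mul]
      exact add_mem (hx.2 k hk) (hy.2 k hk)
  · intro x y _ _ hx hy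
    refine ⟨fun k hk => ?_, fun k hk => ?_⟩
    · rw [mul_assoc]
      exact hx.1 _ (hy.1 k hk)
    · rw [star_mul, mul_assoc]
      exact hy.2 _ (hx.2 k hk)
  · intro x _ hx
    exact ⟨hx.2, by simpa using hx.1⟩

theorem v_mul_mem_monomialSpan (s : S) {k : A} (hk : k ∈ L.leftSpan) :
    L.v s * k ∈ L.monomialSpan := by
  refine Submodule.span_induction (p := fun k _ => L.v s * k ∈ L.monomialSpan) ?_ ?_ ?_ ?_ hk
  · rintro _ (⟨q, rfl⟩ | ⟨p, q, rfl⟩)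
    · exact Submodule.subset_span ⟨(s, q), rfl⟩
    · rw [← mul_assoc, L.L1]
      exact Submodule.subset_span ⟨(s * p, q), rfl⟩
  · simp
  · intro x y _ _ hx hy
    rw [mul_add]
    exact add_mem hx hy
  · intro c x _ hx
    rw [mul_smul_comm]
    exact Submodule.smul_mem _ c hx

/-- Compression by an isometry `v_s` maps `A` into the closed span of the elements `v_p v_q*`. This
removes the monomials with a missing factor, which occur if `S` has no identity. -/
theorem v_mul_mul_star_v_mem_closure (hLCM : IsRightLCM S)
    (hdense : (StarAlgebra.adjoin ℂ (Set.range L.v ∪ Set.range L.e)).topologicalClosure = ⊤)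
    (s : S) (a : A) :
    L.v s * a * star (L.v s) ∈ closure (L.monomialSpan : Set A) := by
  have ha : a ∈ closure
      ((StarAlgebra.adjoin ℂ (Set.range L.v ∪ Set.range L.e) : StarSubalgebra ℂ A) : Set A) := by
    rw [← StarSubalgebra.topologicalClosure_coe, hdense]
    trivial
  refine map_mem_closure (f := fun a => L.v s * a * star (L.v s)) (by fun_prop) ha ?_
  intro b hb
  change L.v s * b * star (L.v s) ∈ L.monomialSpan
  rw [mul_assoc]
  exact L.v_mul_mem_monomialSpan s (L.adjoin_mul_mem_leftSpan hLCM hb (L.star_v_mem_leftSpan s))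

/-- A nonzero atom `f` of the Boolean algebra of the range projections `v_p v_p*`, `p ∈ P`, is
witnessed in `S`: there is `s` whose ideal lies in `pS` if `f ≤ v_p v_p*`, and is disjoint from `pS`
otherwise. Independence shows that the set of points described by `f` is nonempty, and (D3)
replaces a point of this set by a whole ideal. -/
theorem exists_witness_of_atom [Nonempty S] (hLCM : IsRightLCM S) (hD3 : CondD3 S) {f : A} (hf : f ≠ 0)
    (P : Finset S)
    (hP : ∀ p ∈ P, f * (L.v p * star (L.v p)) = f ∨ f * (L.v p * star (L.v p)) = 0) :
    ∃ s : S, ∀ p ∈ P, (f * (L.v p * star (L.v p)) = f ∧ s ∈ principal p) ∨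
      (f * (L.v p * star (L.v p)) = 0 ∧ principal s ∩ principal p = ∅) := by
  classical
  have hX : ∀ Q : Finset S, (∀ p ∈ Q, f * (L.v p * star (L.v p)) = f) →
      ∃ X : J S, f * L.e X = f ∧ ∀ p ∈ Q, X.1 ⊆ principal p := by
    intro Q
    induction Q using Finset.induction_on with
    | empty => exact fun _ => ⟨⟨Set.univ, .univ⟩, by rw [L.L3_univ, mul_one], by simp⟩
    | insert q Q _ ih =>
      intro hQ
      obtain ⟨X, hfX, hXQ⟩ := ih fun p hp => hQ p (Finset.mem_insert_of_mem hp)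
      have hq := hQ q (Finset.mem_insert_self q Q)
      rw [v_mul_star_v] at hq
      refine ⟨⟨X.1 ∩ (principalJ q).1, X.2.inter (principalJ q).2⟩, ?_, fun p hp => ?_⟩
      · rw [← L.L4 X (principalJ q), ← mul_assoc, hfX, hq]
      rcases Finset.mem_insert.1 hp with rfl | hp
      · exact Set.inter_subset_right
      · exact Set.inter_subset_left.trans (hXQ p hp)
  set Q₁ := P.filter fun p => f * (L.v p * star (L.v p)) = f
  set Q₀ := P.filter fun p => f * (L.v p * star (L.v p)) = 0
  obtain ⟨X, hfX, hXQ⟩ := hX Q₁ fun p hp => (Finset.mem_filter.1 hp).2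
  have hne : X.1.Nonempty := by
    rw [Set.nonempty_iff_ne_empty]
    intro h0
    rw [L.e_eq_zero h0, mul_zero] at hfX
    exact hf hfX.symm
  obtain ⟨z, hzX, hz⟩ : ∃ z ∈ X.1, ∀ q ∈ Q₀, z ∉ principal q := by
    by_contra! hcov
    obtain ⟨q, hq, hXq⟩ := subset_principal_of_cover hLCM X.2 hne Q₀ hcov
    have hq0 := (Finset.mem_filter.1 hq).2
    rw [v_mul_star_v] at hq0
    refine hf ?_
    rw [← hfX, ← L.e_mul_e_of_subset (Y := principalJ q) hXq, ← mul_assoc, hfX, hq0]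
  obtain ⟨s, hsX, hs⟩ := hD3.exists_mem hLCM X.2 Q₀ hzX hz
  refine ⟨s, fun p hp => ?_⟩
  rcases hP p hp with h | h
  · exact .inl ⟨h, hXQ p (Finset.mem_filter.2 ⟨hp, h⟩) hsX⟩
  · exact .inr ⟨h, hs p (Finset.mem_filter.2 ⟨hp, h⟩)⟩

/-- The off-diagonal monomials `v_p v_q*`, `p ≠ q`, of a finite set are removed by compression with
a suitable `v_t`, `t ∈ {s} ∪ sS`. -/
theorem exists_compression_eq_zero
    (hsep : ∀ s t : S, s ≠ t → ∃ y, principal (s * y) ∩ principal (t * y) = ∅)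
    (s : S) (F : Finset (S × S))
    (hF : ∀ i ∈ F, (s ∈ principal i.1 ∨ principal s ∩ principal i.1 = ∅) ∧
      (s ∈ principal i.2 ∨ principal s ∩ principal i.2 = ∅)) :
    ∃ t : S, (∀ p, s ∈ principal p → t ∈ principal p) ∧
      (∀ p, principal s ∩ principal p = ∅ → principal t ∩ principal p = ∅) ∧
      ∀ i ∈ F, i.1 ≠ i.2 → star (L.v t) * (L.v i.1 * star (L.v i.2)) * L.v t = 0 := by
  classical
  induction F using Finset.induction_on with
  | empty => exact ⟨s, fun _ h => h, fun _ h => h, by simp⟩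
  | insert i F _ ih =>
    obtain ⟨t, ht₁, ht₀, htF⟩ := ih fun j hj => hF j (Finset.mem_insert_of_mem hj)
    -- Passing from `t` to `ty` preserves what has been achieved for `F`.
    suffices h : ∃ y, i.1 ≠ i.2 →
        star (L.v (t * y)) * (L.v i.1 * star (L.v i.2)) * L.v (t * y) = 0 by
      obtain ⟨y, hy⟩ := h
      refine ⟨t * y, fun p hp => mul_mem_principal_of_mem (ht₁ p hp) y,
        fun p hp => disjoint_principal_of_mem (ht₀ p hp) (mul_mem_principal t y), ?_⟩
      intro j hj hne
      rcases Finset.mem_insert.1 hj with rfl | hj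
      · exact hy hne
      · calc star (L.v (t * y)) * (L.v j.1 * star (L.v j.2)) * L.v (t * y)
            = star (L.v y) * (star (L.v t) * (L.v j.1 * star (L.v j.2)) * L.v t) * L.v y := by
              rw [← L.L1, star_mul]
              simp only [mul_assoc]
          _ = 0 := by rw [htF j hj hne, mul_zero, zero_mul]
    by_cases hne : i.1 = i.2
    · exact ⟨t, fun h => absurd hne h⟩
    have hfac : ∀ y, star (L.v (t * y)) * (L.v i.1 * star (L.v i.2)) * L.v (t * y) =
        (star (L.v (t * y)) * L.v i.1) * (star (L.v i.2) * L.v (t * y)) := fun y => by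
      simp only [mul_assoc]
    obtain ⟨h₁, h₂⟩ := hF i (Finset.mem_insert_self i F)
    rcases h₁ with h₁ | h₁
    · rcases h₂ with h₂ | h₂
      · obtain ⟨a, ha⟩ := mem_principal.1 (ht₁ _ h₁)
        obtain ⟨b, hb⟩ := mem_principal.1 (ht₁ _ h₂)
        have hab : a ≠ b := by
          rintro rfl
          exact hne (mul_right_cancel (ha.trans hb.symm))
        obtain ⟨y, hy⟩ := hsep a b hab
        refine ⟨y, fun _ => ?_⟩
        have h1 : star (L.v (t * y)) * L.v i.1 = star (L.v (a * y)) := by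
          rw [← ha, mul_assoc, star_v_mul_mul_v]
        have h2 : star (L.v i.2) * L.v (t * y) = L.v (b * y) := by
          rw [← hb, mul_assoc, star_v_mul_v_mul]
        rw [hfac, h1, h2, L.star_v_mul_v_of_disjoint hy]
      · refine ⟨t, fun _ => ?_⟩
        have h := disjoint_principal_of_mem (ht₀ _ h₂) (mul_mem_principal t t)
        rw [Set.inter_comm] at h
        rw [hfac, L.star_v_mul_v_of_disjoint h, mul_zero]
    · refine ⟨t, fun _ => ?_⟩
      have h := disjoint_principal_of_mem (ht₀ _ h₁) (mul_mem_principal t t)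
      rw [hfac, L.star_v_mul_v_of_disjoint h, zero_mul]

/-- A linear combination `b` of monomials can be compressed by some `v_t` to a scalar of modulus at
least `‖Φ b‖`. -/
theorem exists_compression_eq_smul_one [Nonempty S] (hLCM : IsRightLCM S) (hD3 : CondD3 S)
    (hsep : ∀ s t : S, s ≠ t → ∃ y, principal (s * y) ∩ principal (t * y) = ∅)
    (Φ : A →ₗ[ℂ] A) (hdiag : ∀ p, Φ (L.v p * star (L.v p)) = L.v p * star (L.v p))
    (hoff : ∀ p q, p ≠ q → Φ (L.v p * star (L.v q)) = 0) {b : A} (hb : b ∈ L.monomialSpan)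
    (hΦb : Φ b ≠ 0) :
    ∃ (t : S) (c : ℂ), star (L.v t) * b * L.v t = c • (1 : A) ∧ ‖Φ b‖ ≤ ‖c‖ := by
  classical
  obtain ⟨l, hl⟩ := Finsupp.mem_span_range_iff_exists_finsupp.1 hb
  rw [Finsupp.sum] at hl
  have hΦ : Φ b = ∑ i ∈ l.support,
      l i • (if i.1 = i.2 then L.v i.1 * star (L.v i.1) else 0) := by
    rw [← hl, map_sum]
    refine Finset.sum_congr rfl fun i _ => ?_
    rw [map_smul]
    split_ifs with h
    · rw [← h, hdiag]
    · rw [hoff _ _ h]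
  have hcomm : ∀ p, Commute (L.v p * star (L.v p)) (Φ b) := fun p => by
    rw [hΦ]
    refine Commute.sum_right _ _ _ fun i _ => Commute.smul_right ?_ _
    split_ifs
    · exact L.commute_range p i.1
    · exact Commute.zero_right _
  set P := l.support.image Prod.fst ∪ l.support.image Prod.snd
  have hP₁ : ∀ i ∈ l.support, i.1 ∈ P := fun i hi =>
    Finset.mem_union_left _ (Finset.mem_image_of_mem _ hi)
  have hP₂ : ∀ i ∈ l.support, i.2 ∈ P := fun i hi =>
    Finset.mem_union_right _ (Finset.mem_image_of_mem _ hi)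
  obtain ⟨f, hf1, -, hfP, hfle⟩ := exists_atom_norm_le L.isStarProjection_range L.commute_range P
    hcomm
  have hf : f ≠ 0 := by
    rintro rfl
    rw [zero_mul, norm_zero] at hfle
    exact hΦb (norm_le_zero_iff.1 hfle)
  obtain ⟨s, hs⟩ := L.exists_witness_of_atom hLCM hD3 hf P hfP
  have hs' : ∀ p ∈ P, s ∈ principal p ∨ principal s ∩ principal p = ∅ := fun p hp =>
    (hs p hp).imp And.right And.right
  obtain ⟨t, ht₁, ht₀, htF⟩ := L.exists_compression_eq_zero hsep s l.support fun i hi =>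
    ⟨hs' _ (hP₁ i hi), hs' _ (hP₂ i hi)⟩
  let c : ℂ := ∑ i ∈ l.support,
    if i.1 = i.2 ∧ f * (L.v i.1 * star (L.v i.1)) = f then l i else 0
  have hfc : f * Φ b = c • f := by
    rw [hΦ, Finset.mul_sum, Finset.sum_smul]
    refine Finset.sum_congr rfl fun i hi => ?_
    rw [mul_smul_comm]
    by_cases h : i.1 = i.2
    · rcases hs _ (hP₁ i hi) with ⟨h1, -⟩ | ⟨h0, -⟩
      · rw [if_pos h, if_pos ⟨h, h1⟩, h1]
      · rw [if_pos h, if_neg fun h2 => hf (h2.2.symm.trans h0), h0, smul_zero, zero_smul]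
    · rw [if_neg h, if_neg fun h2 => h h2.1, mul_zero, smul_zero, zero_smul]
  refine ⟨t, c, ?_, ?_⟩
  · rw [← hl, Finset.mul_sum, Finset.sum_mul, Finset.sum_smul]
    refine Finset.sum_congr rfl fun i hi => ?_
    rw [mul_smul_comm, smul_mul_assoc]
    by_cases h : i.1 = i.2
    · have hfac : star (L.v t) * (L.v i.1 * star (L.v i.2)) * L.v t =
          (star (L.v t) * L.v i.1) * (star (L.v i.1) * L.v t) := by
        rw [← h]
        simp only [mul_assoc]
      rw [hfac]
      rcases hs _ (hP₁ i hi) with ⟨h1, hsi⟩ | ⟨h0, hsi⟩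
      · rw [if_pos ⟨h, h1⟩]
        obtain ⟨y, hy⟩ := mem_principal.1 (ht₁ _ hsi)
        rw [← hy, star_v_mul_mul_v, star_v_mul_v_mul, L.isometry]
      · rw [if_neg fun h2 => hf (h2.2.symm.trans h0), zero_smul,
          L.star_v_mul_v_of_disjoint (ht₀ _ hsi), zero_mul, smul_zero]
    · rw [htF i hi h, if_neg fun h2 => h h2.1, smul_zero, zero_smul]
  · calc ‖Φ b‖ ≤ ‖f * Φ b‖ := hfle
      _ = ‖c‖ * ‖f‖ := by rw [hfc, norm_smul]
      _ ≤ ‖c‖ := mul_le_of_le_one_right (norm_nonneg _) hf1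

/-- The existence of a faithful expectation onto the diagonal makes `x c* c x* = 1` solvable for
`c ≠ 0`: some compression of `c* c` is close to a nonzero scalar, hence invertible. -/
theorem exists_mul_star_mul_self_mul_star_eq_one [Nonempty S] (hLCM : IsRightLCM S) (hD3 : CondD3 S)
    (hsep : ∀ s t : S, s ≠ t → ∃ y, principal (s * y) ∩ principal (t * y) = ∅)
    (hdense : (StarAlgebra.adjoin ℂ (Set.range L.v ∪ Set.range L.e)).topologicalClosure = ⊤)
    (Φ : A →ₗ[ℂ] A) (hdiag : ∀ p, Φ (L.v p * star (L.v p)) = L.v p * star (L.v p))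
    (hoff : ∀ p q, p ≠ q → Φ (L.v p * star (L.v q)) = 0) (hcontr : ∀ a, ‖Φ a‖ ≤ ‖a‖)
    (hfaith : IsFaithful Φ) {c : A} (hc : c ≠ 0) :
    ∃ x : A, x * (star c * c) * star x = 1 := by
  let s : S := Classical.arbitrary S
  have hviso := L.isometry s
  set d := c * star (L.v s) with hd
  have hdd : star d * d = L.v s * (star c * c) * star (L.v s) := by simp [hd, mul_assoc]
  have hd0 : star d * d ≠ 0 := by
    intro h
    rw [CStarRing.star_mul_self_eq_zero_iff] at h
    refine hc ?_
    calc c = c * star (L.v s) * L.v s := by rw [mul_assoc, hviso, mul_one]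
      _ = 0 := by rw [← hd, h, zero_mul]
  have hpos : 0 < ‖Φ (star d * d)‖ := norm_pos_iff.2 fun h => hd0 (hfaith _ ⟨d, rfl⟩ h)
  have hcl := L.v_mul_mul_star_v_mem_closure hLCM hdense s (star c * c)
  rw [← hdd] at hcl
  obtain ⟨b, hb, hdist⟩ := Metric.mem_closure_iff.1 hcl (‖Φ (star d * d)‖ / 2) (half_pos hpos)
  rw [dist_eq_norm] at hdist
  have hΦb : ‖Φ (star d * d)‖ / 2 < ‖Φ b‖ := by
    have h1 := norm_sub_norm_le (Φ (star d * d)) (Φ b)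
    have h2 := hcontr (star d * d - b)
    rw [map_sub] at h2
    linarith
  have hΦb0 : Φ b ≠ 0 := norm_pos_iff.1 ((half_pos hpos).trans hΦb)
  obtain ⟨t, z, htz, hz⟩ := L.exists_compression_eq_smul_one hLCM hD3 hsep Φ hdiag hoff hb hΦb0
  have hvt : ‖L.v t‖ ≤ 1 := by
    have h1 : ‖L.v t‖ * ‖L.v t‖ ≤ 1 := by
      rw [← CStarRing.norm_star_mul_self, L.isometry]
      exact IsStarProjection.norm_le 1 (.one A)
    nlinarith [norm_nonneg (L.v t)]
  set g := star (d * L.v t) * (d * L.v t) with hg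
  have hgz : ‖g - z • (1 : A)‖ < ‖z‖ := by
    have h1 : g - z • (1 : A) = star (L.v t) * (star d * d - b) * L.v t := by
      rw [← htz, hg, star_mul]
      noncomm_ring
    calc ‖g - z • (1 : A)‖ ≤ ‖star (L.v t)‖ * ‖star d * d - b‖ * ‖L.v t‖ := by
          rw [h1]
          exact (norm_mul_le _ _).trans
            (mul_le_mul_of_nonneg_right (norm_mul_le _ _) (norm_nonneg _))
      _ ≤ 1 * ‖star d * d - b‖ * 1 := by
          rw [norm_star]
          gcongr
      _ < ‖z‖ := by linarith
  have hz0 : z ≠ 0 := norm_pos_iff.1 ((norm_nonneg _).trans_lt hgz)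
  have hu : IsUnit g := by
    have h1 : ‖1 - z⁻¹ • g‖ < 1 := by
      have h2 : 1 - z⁻¹ • g = -(z⁻¹ • (g - z • (1 : A))) := by
        rw [smul_sub, smul_smul, inv_mul_cancel₀ hz0, one_smul, neg_sub]
      rw [h2, norm_neg, norm_smul, norm_inv, inv_mul_lt_one₀ (norm_pos_iff.2 hz0)]
      exact hgz
    have h3 := isUnit_one_sub_of_norm_lt_one h1
    rw [sub_sub_cancel] at h3
    have h4 : g = algebraMap ℂ A z * (z⁻¹ • g) := by
      rw [← Algebra.smul_def, smul_smul, mul_inv_cancel₀ hz0, one_smul]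
    rw [h4]
    exact ((IsUnit.mk0 z hz0).map (algebraMap ℂ A)).mul h3
  obtain ⟨x, hx⟩ := exists_mul_mul_star_eq_one hu
  refine ⟨x * star (L.v t) * L.v s, ?_⟩
  rw [← hx, hd]
  simp [mul_assoc]

end LiFamily

/-! ### The left regular representation -/

section RegularRepresentation

variable {S : Type u} [Semigroup S] [IsCancelMul S]
  {H : Type*} [NormedAddCommGroup H] [InnerProductSpace ℂ H]

theorem ext_of_hilbertBasis {ι : Type*} (b : HilbertBasis ι ℂ H) {T T' : H →L[ℂ] H}
    (h : ∀ i, T (b i) = T' (b i)) : T = T' := by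
  refine ContinuousLinearMap.ext_on (s := Set.range b) ?_ ?_
  · rw [Submodule.dense_iff_topologicalClosure_eq_top]
    exact b.dense_span
  · rintro _ ⟨i, rfl⟩
    exact h i

variable [CompleteSpace H]

/-- The isometry of the Hilbert space with basis `(δ_s)` given by `δ_s ↦ δ_{ps}`. -/
noncomputable def shift (b : HilbertBasis S ℂ H) (p : S) : H →L[ℂ] H :=
  ((b.orthonormal.comp (p * ·) (mul_right_injective p)).orthogonalFamily.linearIsometry.comp
    b.repr.toLinearIsometry).toContinuousLinearMap

theorem shift_apply (b : HilbertBasis S ℂ H) (p s : S) : shift b p (b s) = b (p * s) := by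
  classical
  change OrthogonalFamily.linearIsometry
    (b.orthonormal.comp (p * ·) (mul_right_injective p)).orthogonalFamily (b.repr (b s)) = _
  rw [b.repr_self, OrthogonalFamily.linearIsometry_apply_single]
  exact one_smul ℂ _

theorem star_shift_mul_shift (b : HilbertBasis S ℂ H) (p : S) :
    star (shift b p) * shift b p = 1 := by
  rw [ContinuousLinearMap.star_eq_adjoint]
  exact (ContinuousLinearMap.norm_map_iff_adjoint_comp_self _).1
    (LinearIsometry.norm_map _)

theorem star_shift_apply_of_notMem (b : HilbertBasis S ℂ H) {p s : S} (h : s ∉ principal p) :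
    star (shift b p) (b s) = 0 := by
  classical
  refine b.repr.injective (lp.ext (funext fun t => ?_))
  rw [b.repr_apply_apply, ContinuousLinearMap.star_eq_adjoint,
    ContinuousLinearMap.adjoint_inner_right, shift_apply, orthonormal_iff_ite.1 b.orthonormal,
    if_neg fun hts => h (mem_principal.2 ⟨t, hts⟩)]
  simp

theorem star_shift_apply_mul (b : HilbertBasis S ℂ H) (p s : S) :
    star (shift b p) (b (p * s)) = b s := by
  rw [← shift_apply]
  exact DFunLike.congr_fun (star_shift_mul_shift b p) (b s)

/-- The projection onto the closed span of the basis vectors `δ_x`, `x ∈ X`. -/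
noncomputable def basisProj {ι : Type*} (b : HilbertBasis ι ℂ H) (X : Set ι) : H →L[ℂ] H :=
  (Submodule.span ℂ (b '' X)).topologicalClosure.starProjection

theorem basisProj_apply_of_mem {ι : Type*} (b : HilbertBasis ι ℂ H) {X : Set ι} {i : ι}
    (h : i ∈ X) : basisProj b X (b i) = b i :=
  Submodule.starProjection_eq_self_iff.2
    (Submodule.le_topologicalClosure _ (Submodule.subset_span ⟨i, h, rfl⟩))

theorem basisProj_apply_of_notMem {ι : Type*} (b : HilbertBasis ι ℂ H) {X : Set ι} {i : ι}
    (h : i ∉ X) : basisProj b X (b i) = 0 := by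
  classical
  refine (Submodule.starProjection_apply_eq_zero_iff _).2 ?_
  rw [Submodule.orthogonal_closure, Submodule.mem_orthogonal]
  intro u hu
  refine Submodule.span_induction (p := fun u _ => inner ℂ u (b i) = 0) ?_ ?_ ?_ ?_ hu
  · rintro _ ⟨j, hj, rfl⟩
    rw [orthonormal_iff_ite.1 b.orthonormal, if_neg]
    rintro rfl
    exact h hj
  · exact inner_zero_left _
  · intro x y _ _ hx hy
    rw [inner_add_left, hx, hy, add_zero]
  · intro c x _ hx
    rw [inner_smul_left, hx, mul_zero]

/-- The left regular representation of `S` on the Hilbert space with basis indexed by `S`. -/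
noncomputable def regularFamily (b : HilbertBasis S ℂ H) : LiFamily S (H →L[ℂ] H) where
  v := shift b
  e X := basisProj b X.1
  isometry := star_shift_mul_shift b
  projection _ := isStarProjection_starProjection
  L1 p q := ext_of_hilbertBasis b fun s => by
    rw [mul_apply_eq_comp, shift_apply, shift_apply, shift_apply, mul_assoc]
  L2 p X := ext_of_hilbertBasis b fun s => by
    rw [mul_apply_eq_comp, mul_apply_eq_comp]
    by_cases hs : s ∈ principal p
    · obtain ⟨t, rfl⟩ := mem_principal.1 hs
      rw [star_shift_apply_mul]
      by_cases ht : t ∈ X.1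
      · rw [basisProj_apply_of_mem b ht, shift_apply]
        exact (basisProj_apply_of_mem b (Set.mem_image_of_mem _ ht)).symm
      · rw [basisProj_apply_of_notMem b ht, map_zero, basisProj_apply_of_notMem b]
        rintro ⟨t', ht', h⟩
        exact ht (mul_left_cancel h ▸ ht')
    · rw [star_shift_apply_of_notMem b hs, map_zero, map_zero, basisProj_apply_of_notMem b]
      rintro ⟨t, -, rfl⟩
      exact hs (mul_mem_principal p t)
  L3_empty := ext_of_hilbertBasis b fun s => basisProj_apply_of_notMem b (Set.notMem_empty s)
  L3_univ := ext_of_hilbertBasis b fun s => basisProj_apply_of_mem b (Set.mem_univ s)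
  L4 X Y := ext_of_hilbertBasis b fun s => by
    rw [mul_apply_eq_comp]
    by_cases hY : s ∈ Y.1
    · rw [basisProj_apply_of_mem b hY]
      by_cases hX : s ∈ X.1
      · rw [basisProj_apply_of_mem b hX, basisProj_apply_of_mem b (Set.mem_inter hX hY)]
      · rw [basisProj_apply_of_notMem b hX, basisProj_apply_of_notMem b fun h => hX h.1]
    · rw [basisProj_apply_of_notMem b hY, map_zero, basisProj_apply_of_notMem b fun h => hY h.2]

end RegularRepresentation

/-! ### The full semigroup C*-algebra -/

section FullAlgebra

variable (S : Type u) [Semigroup S] [IsCancelMul S]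

/-- The left regular representation on `ℓ²(S)`. -/
noncomputable def regularRep [Nonempty S] : LiRep S where
  B := lp (fun _ : S => ℂ) 2 →L[ℂ] lp (fun _ : S => ℂ) 2
  nontrivial := by
    have b : HilbertBasis S ℂ (lp (fun _ : S => ℂ) 2) := ⟨LinearIsometryEquiv.refl ℂ _⟩
    have : Nontrivial (lp (fun _ : S => ℂ) 2) :=
      ⟨b (Classical.arbitrary S), 0, b.orthonormal.ne_zero _⟩
    infer_instance
  family := regularFamily ⟨LinearIsometryEquiv.refl ℂ _⟩

/-- `C*(S)` does not collapse, since the left regular representation is nonzero. -/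
theorem nontrivial_fullAlgebra [Nonempty S] : Nontrivial (FullAlgebra S) := by
  refine ⟨1, 0, fun h => ?_⟩
  have h1 : ((1 : FullAlgebra S) : BigProduct S) (regularRep S) =
      ((0 : FullAlgebra S) : BigProduct S) (regularRep S) := by rw [h]
  exact one_ne_zero (α := (regularRep S).B) h1

/-- The canonical family of generators of `C*(S)`. -/
noncomputable def canonicalFamily : LiFamily S (FullAlgebra S) where
  v := v
  e := e
  isometry p := Subtype.ext (lp.ext (funext fun i => i.family.isometry p))
  projection X :=
    ⟨Subtype.ext (lp.ext (funext fun i => (i.family.projection X).isIdempotentElem)),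
      Subtype.ext (lp.ext (funext fun i => (i.family.projection X).isSelfAdjoint))⟩
  L1 p q := Subtype.ext (lp.ext (funext fun i => i.family.L1 p q))
  L2 p X := Subtype.ext (lp.ext (funext fun i => i.family.L2 p X))
  L3_empty := Subtype.ext (lp.ext (funext fun i => i.family.L3_empty))
  L3_univ := Subtype.ext (lp.ext (funext fun i => i.family.L3_univ))
  L4 X Y := Subtype.ext (lp.ext (funext fun i => i.family.L4 X Y))

theorem adjoin_canonicalFamily_dense :
    (StarAlgebra.adjoin ℂ (Set.range (canonicalFamily S).v ∪
      Set.range (canonicalFamily S).e)).topologicalClosure = ⊤ := by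
  refine top_le_iff.1 fun a _ => ?_
  rw [← SetLike.mem_coe, StarSubalgebra.topologicalClosure_coe, Metric.mem_closure_iff]
  intro ε hε
  have ha : (a : BigProduct S) ∈ closure ((StarAlgebra.adjoin ℂ
      (Set.range (vBig (S := S)) ∪ Set.range eBig) : StarSubalgebra ℂ (BigProduct S)) :
        Set (BigProduct S)) := by
    rw [← StarSubalgebra.topologicalClosure_coe]
    exact a.2
  obtain ⟨x, hx, hax⟩ := Metric.mem_closure_iff.1 ha ε hε
  have himage : (fullSubalgebra S).subtype '' (Set.range (canonicalFamily S).v ∪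
      Set.range (canonicalFamily S).e) = Set.range (vBig (S := S)) ∪ Set.range eBig := by
    rw [Set.image_union, ← Set.range_comp, ← Set.range_comp]
    rfl
  rw [SetLike.mem_coe, ← himage, ← StarAlgHom.map_adjoin] at hx
  obtain ⟨y, hy, rfl⟩ := hx
  exact ⟨y, hy, hax⟩

end FullAlgebra

end SemigroupCStar

theorem mainTheorem2 {S : Type u} [Semigroup S] [IsCancelMul S] [Nontrivial S]
    (hLCM : IsRightLCM S)
    (hNoUnits : unitSet S = ∅ → ∀ a b : S, principal a = principal b → a = b)
    (hΦ : ∃ Φ : FullAlgebra S →ₗ[ℂ] FullAlgebra S,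
      IsDiagonalMap Φ ∧ IsConditionalExpectation (diagonal S) Φ ∧ IsFaithful Φ)
    (hD3 : CondD3 S)
    (hcases : (unitSet S).encard ≤ 1 ∨
      (1 < (unitSet S).encard ∧ CondD2 S) ∨
      (1 < (unitSet S).encard ∧ CondD1 S ∧ StronglyEffective S)) :
    IsPurelyInfinite (FullAlgebra S) ∧ IsSimple (FullAlgebra S) := by
  obtain ⟨Φ, hdiag, hexp, hfaith⟩ := hΦ
  have := nontrivial_fullAlgebra S
  have hunit : ∀ x ∈ nontrivialUnits S, ∃ y, principal y ∩ principal (x * y) = ∅ :=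
    fun x hx => exists_disjoint_unit_mul hcases hx
  have hkey : ∀ c : FullAlgebra S, c ≠ 0 → ∃ x, x * (star c * c) * star x = 1 := fun c hc =>
    (canonicalFamily S).exists_mul_star_mul_self_mul_star_eq_one hLCM hD3
      (fun s t hst => exists_disjoint_mul_right hNoUnits hD3 hunit hst)
      (adjoin_canonicalFamily_dense S) Φ hdiag.diag hdiag.off_diag hexp.contractive hfaith hc
  refine ⟨?_, isSimple_of_forall_exists hkey⟩
  obtain ⟨s, t, hst⟩ := exists_disjoint_principal hLCM hD3 hunit
  refine isPurelyInfinite_of_forall_exists hkey ((canonicalFamily S).isometry s) fun h => ?_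
  -- A unitary `v_s` is impossible, since `v_t` has range projection orthogonal to that of `v_s`.
  have h0 := (canonicalFamily S).star_v_mul_v_of_disjoint hst
  have h1 : (canonicalFamily S).v t = 0 := by
    rw [← one_mul ((canonicalFamily S).v t), ← h, mul_assoc, h0, mul_zero]
  have h2 := (canonicalFamily S).isometry t
  rw [h1, mul_zero] at h2
  exact zero_ne_one h2
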